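/- Let $F$ be a finite field. A linear systematic $(n,k,r,t)$ batch code over $F$ is an injective linear map $\mathcal{C}:F^k\to F^n$ such that $x$ is a sub-vector of $y=\mathcal{C}(x)$ for every $x\in F^k$, together with a decoding map $\mathcal{D}:F^n\times[k]^t\to F^t$ such that, for every query $(i_1,\dots,i_t)\in[k]^t$ (repetitions allowed), $\mathcal{D}(\mathcal{C}(x),i_1,\dots,i_t)=(x_{i_1},\dots,x_{i_t})$ for all $x\in F^k$, and there are $t$ pairwise disjoint recovery sets $R_1,\dots,R_t\subseteq[n]$ of size at most $r$ each such that the $\ell$-th output symbol is computed from the coordinates of $y$ in $R_\ell$ only, $1\le\ell\le t$. Let $\mathcal{B}(k,r,t)$ denote the shortest length $n$ of a linear systematic $(n,k,r,t)$ batch code over $F$. Proposition. Let $r=2$ and $t\in\{3,4\}$. For every $k\ge 1$ such codes exist, so that $\mathcal{B}(k,2,t)$ is well defined and attained, and $$k+t-2+\left\lceil\frac{(t-1)(k-1)+1}{t}\right\rceil\le\mathcal{B}(k,2,t).$$ For every $k\ge 3$, moreover, $$\mathcal{B}(k,2,t)\le k+\left\lceil (t-1)\cdot\frac{k}{2}\right\rceil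 .$$ -/

import Mathlib

/-- `encode : Q^k → Q^n` is an `(n, k, r, t)` batch code over the alphabet `Q`: it is injective and
has a decoding map `decode : Q^n × [k]^t → Q^t` that answers every query `(i_1, …, i_t)` (repetitions
allowed) correctly, where for each query there are `t` pairwise disjoint recovery sets of at most `r`
coordinates such that the `l`-th requested symbol is computed from the coordinates in the `l`-th
recovery set only. -/
def IsBatchCode {Q : Type*} {k n : ℕ} (r t : ℕ) (encode : (Fin k → Q) → (Fin n → Q)) : Prop :=
  Function.Injective encode ∧
    ∃ decode : (Fin n → Q) → (Fin t → Fin k) → (Fin t → Q),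
      (∀ (x : Fin k → Q) (i : Fin t → Fin k), decode (encode x) i = fun l => x (i l)) ∧
      ∀ i : Fin t → Fin k, ∃ R : Fin t → Finset (Fin n),
        (∀ l m : Fin t, l ≠ m → Disjoint (R l) (R m)) ∧
        (∀ l : Fin t, (R l).card ≤ r) ∧
        ∀ (l : Fin t) (y y' : Fin n → Q), (∀ j ∈ R l, y j = y' j) → decode y i l = decode y' i l

/-- The encoding is systematic: the information vector `x` is a sub-vector of its encoding. -/
def IsSystematic {Q : Type*} {k n : ℕ} (encode : (Fin k → Q) → (Fin n → Q)) : Prop :=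
  ∃ s : Fin k ↪ Fin n, ∀ (x : Fin k → Q) (i : Fin k), encode x (s i) = x i

/-- There is a linear systematic `(n, k, r, t)` batch code over the field `F`. -/
def ExistsLinearSystematicBatchCode (F : Type*) [Field F] (n k r t : ℕ) : Prop :=
  ∃ encode : (Fin k → F) →ₗ[F] (Fin n → F), IsSystematic encode ∧ IsBatchCode r t encode

/-- The optimal (shortest) length of a linear systematic batch code over `F` with dimension `k`,
recovery sets of size at most `r` and queries of size `t`. -/
noncomputable def optimalBatchLength (F : Type*) [Field F] (k r t : ℕ) : ℕ :=
  sInf {n : ℕ | ExistsLinearSystematicBatchCode F n k r t}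

/-!
*Upper bound.* A graph on the information symbols yields a code by appending the parity
`x v + x w` of every edge. In a query, one occurrence of `v` is read off directly and any other is
recovered from a neighbour `w` outside the query together with the edge `vw`; by Hall's theorem
distinct neighbours can be chosen as soon as all degrees are at least `t - 1`. For `t ≤ k` the
Harary graph has such degrees and `⌈(t - 1) k / 2⌉` edges. The case `k = 3`, `t = 4` is covered by
the simplex code of length `7`.

*Lower bound.* View the coordinates of a code as functionals on `F ^ k`. A nonzero codeword has
weight at least `t`, so a proper subspace `V` of the dual misses at least `t` coordinates, and it
suffices that some `V` of dimension at most `k - 1` contains `2 (k - 1) - ⌈(k - 1) / t⌉` of them.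
To enlarge `V`, adjoin a systematic coordinate `s` outside it. By exchange, each of the `t - 1`
disjoint recovery sets of `s` gains a coordinate at once, or gains two after one of its coordinates
is adjoined too. If `m` sets are of the second kind, adjoining a coordinate from each of them raises
the dimension by `m + 1 ≤ t` and the number of coordinates by at least `t + m`: one coordinate at
most is lost against two per dimension, and only where the dimension rises by `t`. The last step
adjoins only as many of them as the dimension allows.
-/

open Finset Module Submodule
open scoped Function

section RecoverySets

variable {R : Type*} [Ring R] {ι κ : Type*} {r t : ℕ}

/-- The coordinates in `P` of a codeword `g x` determine the information symbol `x a`. By linearity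
this is expressed as: the symbol vanishes whenever these coordinates do. -/
def IsRecoverySet (g : (κ → R) →ₗ[R] (ι → R)) (a : κ) (P : Finset ι) : Prop :=
  ∀ x, (∀ j ∈ P, g x j = 0) → x a = 0

/-- Every query of `t` information symbols, repetitions allowed, has pairwise disjoint recovery
sets of at most `r` coordinates. This is the batch property of a linear encoding without its
decoding map; symbols and coordinates may be indexed by arbitrary types. -/
def HasRecoverySets (r t : ℕ) (g : (κ → R) →ₗ[R] (ι → R)) : Prop :=
  ∀ i : Fin t → κ, ∃ P : Fin t → Finset ι, Pairwise (Disjoint on P) ∧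
    ∀ l, #(P l) ≤ r ∧ IsRecoverySet g (i l) (P l)

theorem IsRecoverySet.apply_eq {g : (κ → R) →ₗ[R] (ι → R)} {a : κ} {P : Finset ι}
    (h : IsRecoverySet g a P) {x y : κ → R} (hxy : ∀ j ∈ P, g x j = g y j) : x a = y a :=
  sub_eq_zero.1 <| h (x - y) fun j hj => by simp [hxy j hj]

theorem IsRecoverySet.map_equiv {ι' : Type*} {g : (κ → R) →ₗ[R] (ι → R)} {κ' : Type*} {a : κ}
    {P : Finset ι} (h : IsRecoverySet g a P) (e : ι ≃ ι') (f : κ ≃ κ') :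
    IsRecoverySet (LinearMap.funLeft R R e.symm ∘ₗ g ∘ₗ LinearMap.funLeft R R f) (f a)
      (P.map e.toEmbedding) := by
  intro x hx
  refine h (LinearMap.funLeft R R f x) fun j hj => ?_
  simpa using hx (e j) (mem_map_of_mem _ hj)

theorem HasRecoverySets.map_equiv {ι' κ' : Type*} {g : (κ → R) →ₗ[R] (ι → R)}
    (h : HasRecoverySets r t g) (e : ι ≃ ι') (f : κ ≃ κ') :
    HasRecoverySets r t (LinearMap.funLeft R R e.symm ∘ₗ g ∘ₗ LinearMap.funLeft R R f) := by
  intro i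
  obtain ⟨P, hdisj, hP⟩ := h (f.symm ∘ i)
  refine ⟨fun l => (P l).map e.toEmbedding, fun l m hlm => ?_, fun l => ⟨?_, ?_⟩⟩
  · simpa [Function.onFun, disjoint_map] using hdisj hlm
  · simpa using (hP l).1
  · simpa using (hP l).2.map_equiv e f

theorem IsBatchCode.hasRecoverySets {k n : ℕ} {g : (Fin k → R) →ₗ[R] (Fin n → R)}
    (h : IsBatchCode r t g) : HasRecoverySets r t g := by
  obtain ⟨-, decode, hdecode, hP⟩ := h
  intro i
  obtain ⟨P, hdisj, hcard, hlocal⟩ := hP i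
  refine ⟨P, fun l m => hdisj l m, fun l => ⟨hcard l, fun x hx => ?_⟩⟩
  have hx0 : decode (g x) i l = decode (g 0) i l := hlocal l _ _ fun j hj => by simp [hx j hj]
  rw [hdecode, hdecode] at hx0
  simpa using hx0

theorem HasRecoverySets.isBatchCode {k n : ℕ} {g : (Fin k → R) →ₗ[R] (Fin n → R)}
    (h : HasRecoverySets r t g) (hg : Function.Injective g) : IsBatchCode r t g := by
  choose P hdisj hP using h
  have hfactors (i l) : Function.FactorsThrough (fun x : Fin k → R => x (i l))
      fun x => (P i l).restrict (g x) :=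
    fun x y hxy => (hP i l).2.apply_eq fun j hj => congrFun hxy ⟨j, hj⟩
  refine ⟨hg, fun y i l => Function.extend (fun x => (P i l).restrict (g x)) (fun x => x (i l)) 0
    ((P i l).restrict y), fun x i => funext fun l => (hfactors i l).extend_apply 0 x,
    fun i => ⟨P i, fun l m => @hdisj i l m, fun l => (hP i l).1, fun l y y' hy => ?_⟩⟩
  have hrestrict : (P i l).restrict y = (P i l).restrict y' := funext fun j => hy j j.2
  simp only [hrestrict]

theorem IsSystematic.injective {k n : ℕ} {Q : Type*} {encode : (Fin k → Q) → (Fin n → Q)}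
    (h : IsSystematic encode) : Function.Injective encode := by
  obtain ⟨s, hs⟩ := h
  exact fun x y hxy => funext fun i => by rw [← hs x i, hxy, hs y i]

theorem HasRecoverySets.existsLinearSystematicBatchCode {F : Type*} [Field F] [Fintype ι]
    [Fintype κ] {g : (κ → F) →ₗ[F] (ι → F)} (h : HasRecoverySets r t g) (s : κ ↪ ι)
    (hs : ∀ x a, g x (s a) = x a) :
    ExistsLinearSystematicBatchCode F (Fintype.card ι) (Fintype.card κ) r t := by
  let e := Fintype.equivFin ι
  let f := Fintype.equivFin κ
  have hsys : IsSystematic (LinearMap.funLeft F F e.symm ∘ₗ g ∘ₗ LinearMap.funLeft F F f) :=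
    ⟨f.symm.toEmbedding.trans (s.trans e.toEmbedding), fun x i => by simp [hs]⟩
  exact ⟨_, hsys, (h.map_equiv e f).isBatchCode hsys.injective⟩

end RecoverySets

section RepetitionCode

theorem hasRecoverySets_repetition (R κ : Type*) [Ring R] (t : ℕ) {r : ℕ} (hr : 1 ≤ r) :
    HasRecoverySets r t (LinearMap.funLeft R R (Prod.fst : κ × Fin t → κ)) :=
  fun i => ⟨fun l => {(i l, l)}, fun l m hlm => by simp [Function.onFun, hlm],
    fun l => ⟨by simpa using hr, fun _ hx => by simpa using hx⟩⟩

theorem existsLinearSystematicBatchCode_repetition (F : Type*) [Field F] (k : ℕ) {r t : ℕ}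
    (hr : 1 ≤ r) (ht : 0 < t) : ExistsLinearSystematicBatchCode F (k * t) k r t := by
  simpa using (hasRecoverySets_repetition F (Fin k) t hr).existsLinearSystematicBatchCode
    ⟨fun a => (a, ⟨0, ht⟩), fun a b hab => (Prod.ext_iff.1 hab).1⟩ fun _ _ => rfl

end RepetitionCode

section GraphCode

variable {R V : Type*} [Ring R] (G : SimpleGraph V)

/-- The encoding that appends to `x` the parity symbol `x v + x w` of every edge `vw` of `G`. -/
def graphEncoding (R : Type*) [Ring R] : (V → R) →ₗ[R] (V ⊕ G.edgeSet → R) :=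
  LinearMap.pi <| Sum.elim LinearMap.proj fun e =>
    Sym2.lift ⟨fun v w => LinearMap.proj v + LinearMap.proj w, fun _ _ => add_comm _ _⟩ e.1

variable {G}

theorem isRecoverySet_graphEncoding_singleton (v : V) :
    IsRecoverySet (graphEncoding G R) v {Sum.inl v} :=
  fun _ hx => hx _ (mem_singleton_self _)

theorem isRecoverySet_graphEncoding_pair [DecidableEq (V ⊕ G.edgeSet)] {v w : V}
    (h : G.Adj v w) :
    IsRecoverySet (graphEncoding G R) v {Sum.inl w, Sum.inr ⟨s(v, w), h⟩} := by
  intro x hx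
  have hw : x w = 0 := hx (Sum.inl w) (by simp)
  have hvw : x v + x w = 0 := hx (Sum.inr ⟨s(v, w), h⟩) (by simp)
  rwa [hw, add_zero] at hvw

theorem exists_injective_of_card_le {α β : Type*} [Fintype α] {N : α → Finset β}
    (h : ∀ a, Fintype.card α ≤ #(N a)) : ∃ f : α → β, Function.Injective f ∧ ∀ a, f a ∈ N a := by
  classical
  refine (all_card_le_biUnion_card_iff_exists_injective N).1 fun A => ?_
  obtain rfl | ⟨a, ha⟩ := A.eq_empty_or_nonempty
  · simp
  · exact A.card_le_univ.trans ((h a).trans (card_le_card (subset_biUnion_of_mem N ha)))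

theorem exists_injective_eq_or_adj [Fintype V] [DecidableRel G.Adj] {t : ℕ}
    (hdeg : ∀ v, t ≤ G.degree v + 1) (i : Fin t → V) :
    ∃ f : Fin t → V, Function.Injective f ∧
      ∀ l, f l = i l ∨ G.Adj (i l) (f l) ∧ f l ∉ Set.range i := by
  classical
  obtain ⟨P, -, hinj, himage⟩ := exists_subset_injOn_image_eq_of_surjOn (f := i)
    (s := Set.univ) (univ.image i) (by simpa using Set.surjOn_image i Set.univ)
  have hmem (m) : i m ∈ univ.image i := mem_image_of_mem i (mem_univ m)
  have hcard : #(univ.image i) + Fintype.card ↥Pᶜ = t := by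
    rw [← himage, card_image_of_injOn hinj, Fintype.card_coe, card_add_card_compl,
      Fintype.card_fin]
  -- Hall's condition: each of the repeated occurrences has at least as many neighbours outside the
  -- query as there are repeated occurrences.
  have hneighbours (l : ↥Pᶜ) : Fintype.card ↥Pᶜ ≤ #(G.neighborFinset (i l) \ univ.image i) := by
    have hlt : #(univ.image i ∩ G.neighborFinset (i l)) < #(univ.image i) :=
      card_lt_card ⟨inter_subset_left, fun h => by simpa using h (hmem l)⟩
    have hsdiff := card_sdiff_add_card_inter (G.neighborFinset (i l)) (univ.image i)
    have := hdeg (i l)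
    rw [inter_comm, G.card_neighborFinset_eq_degree] at hsdiff
    omega
  obtain ⟨f, hf, hfN⟩ := exists_injective_of_card_le hneighbours
  simp only [mem_sdiff, SimpleGraph.mem_neighborFinset, mem_image, mem_univ, true_and] at hfN
  refine ⟨fun l => if hl : l ∈ P then i l else f ⟨l, mem_compl.2 hl⟩, fun l m hlm => ?_,
    fun l => ?_⟩
  · by_cases hl : l ∈ P <;> by_cases hm : m ∈ P <;>
      simp only [hl, hm, dite_true, dite_false] at hlm
    · exact hinj hl hm hlm
    · exact absurd ⟨l, hlm⟩ (hfN _).2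
    · exact absurd ⟨m, hlm.symm⟩ (hfN _).2
    · simpa using hf hlm
  · by_cases hl : l ∈ P
    · simp [hl]
    · simpa [hl] using Or.inr (hfN ⟨l, mem_compl.2 hl⟩)

theorem hasRecoverySets_graphEncoding [Fintype V] [DecidableRel G.Adj] {t : ℕ}
    (hdeg : ∀ v, t ≤ G.degree v + 1) : HasRecoverySets 2 t (graphEncoding G R) := by
  classical
  intro i
  obtain ⟨f, hf, hfi⟩ := exists_injective_eq_or_adj hdeg i
  have hset (l) : ∃ P : Finset (V ⊕ G.edgeSet),
      (#P ≤ 2 ∧ IsRecoverySet (graphEncoding G R) (i l) P) ∧ ∀ c ∈ P, c = Sum.inl (f l) ∨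
        f l ∉ Set.range i ∧ ∃ h : G.Adj (i l) (f l), c = Sum.inr ⟨s(i l, f l), h⟩ := by
    rcases hfi l with hl | ⟨hadj, hl⟩
    · refine ⟨{Sum.inl (i l)}, ⟨by simp, isRecoverySet_graphEncoding_singleton _⟩, ?_⟩
      simp [hl]
    · refine ⟨{Sum.inl (f l), Sum.inr ⟨s(i l, f l), hadj⟩},
        ⟨card_le_two, isRecoverySet_graphEncoding_pair hadj⟩, ?_⟩
      simp [hl, hadj]
  choose P hP hPmem using hset
  refine ⟨P, fun l m hlm => disjoint_left.2 fun c hl hm => hlm (hf ?_), hP⟩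
  rcases hPmem l c hl with hl | ⟨hfl, _, hl⟩ <;> rcases hPmem m c hm with hm | ⟨-, _, hm⟩
  · exact Sum.inl_injective (hl.symm.trans hm)
  · simp [hl] at hm
  · simp [hl] at hm
  · have hedge := congrArg Subtype.val (Sum.inr_injective (hl.symm.trans hm))
    exact (Sym2.eq_iff.1 hedge).elim And.right fun h => absurd ⟨m, h.2.symm⟩ hfl

theorem existsLinearSystematicBatchCode_graph (F : Type*) [Field F] [Fintype V]
    [DecidableRel G.Adj] {t : ℕ} (hdeg : ∀ v, t ≤ G.degree v + 1) :
    ExistsLinearSystematicBatchCode F (Fintype.card V + #G.edgeFinset) (Fintype.card V) 2 t := by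
  simpa [SimpleGraph.edgeFinset_card] using
    (hasRecoverySets_graphEncoding hdeg).existsLinearSystematicBatchCode
    ⟨Sum.inl, Sum.inl_injective⟩ fun (_ : V → F) _ => rfl

end GraphCode

section HararyGraph

/-- The edges of the Harary graph on `ℤ/k`. For `d < k` all its degrees are `d`, except for one
vertex of degree `d + 1` if `d` and `k` are odd: `v` is joined to `v ± a` for `1 ≤ a ≤ d / 2`, and
if `d` is odd then `v` is joined to `v + ⌈k / 2⌉` for `0 ≤ v < ⌈k / 2⌉`. -/
def hararyEdges (k d : ℕ) : Finset (Sym2 (ZMod k)) :=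
  (range k ×ˢ Icc 1 (d / 2) ∪ range (d % 2 * ((k + 1) / 2)) ×ˢ {(k + 1) / 2}).image
    fun p => s((p.1 : ZMod k), (p.1 : ZMod k) + (p.2 : ZMod k))

/-- The Harary graph, which for `d < k` has the least possible number of edges among the graphs on
`ℤ/k` with all degrees at least `d`. -/
def hararyGraph (k d : ℕ) : SimpleGraph (ZMod k) :=
  SimpleGraph.fromEdgeSet (hararyEdges k d)

theorem two_mul_card_hararyEdges_le (k d : ℕ) : 2 * #(hararyEdges k d) ≤ d * k + 1 := by
  have hcard : #(hararyEdges k d) ≤ k * (d / 2) + d % 2 * ((k + 1) / 2) := by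
    refine card_image_le.trans ((card_union_le _ _).trans ?_)
    simp
  obtain ⟨m, rfl | rfl⟩ := Nat.even_or_odd' d
  · rw [show 2 * m / 2 = m by omega, show 2 * m % 2 = 0 by omega, zero_mul] at hcard
    linarith
  · have : 2 * ((k + 1) / 2) ≤ k + 1 := Nat.mul_div_le _ _
    rw [show (2 * m + 1) / 2 = m by omega, show (2 * m + 1) % 2 = 1 by omega] at hcard
    linarith

variable {k d : ℕ}

theorem hararyGraph_adj_add {v : ZMod k} {a : ℕ} (ha : 1 ≤ a) (hak : a < k)
    (hv : s(v, v + a) ∈ hararyEdges k d) : (hararyGraph k d).Adj v (v + a) := by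
  refine (SimpleGraph.fromEdgeSet_adj _).2 ⟨hv, fun h => ?_⟩
  rw [left_eq_add, ZMod.natCast_eq_zero_iff] at h
  exact absurd (Nat.le_of_dvd ha h) hak.not_ge

variable [NeZero k]

theorem mem_hararyEdges_of_le {a : ℕ} (ha : 1 ≤ a) (had : a ≤ d / 2) (v : ZMod k) :
    s(v, v + a) ∈ hararyEdges k d :=
  mem_image.2 ⟨(v.val, a), by simp [ha, had, v.val_lt], by simp⟩

theorem mem_hararyEdges_of_ge {a : ℕ} (ha : k - d / 2 ≤ a) (hak : a < k) (v : ZMod k) :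
    s(v, v + a) ∈ hararyEdges k d := by
  have hreturn : v + a + ((k - a : ℕ) : ZMod k) = v := by
    rw [Nat.cast_sub hak.le, ZMod.natCast_self]
    ring
  have := mem_hararyEdges_of_le (d := d) (a := k - a) (by omega) (by omega)
    (v + (a : ZMod k))
  rwa [hreturn, Sym2.eq_swap] at this

theorem exists_chord_mem_hararyEdges (hd : Odd d) (hdk : d < k) (v : ZMod k) :
    ∃ a, d / 2 < a ∧ a < k - d / 2 ∧ s(v, v + a) ∈ hararyEdges k d := by
  have hmod := Nat.odd_iff.1 hd
  rcases lt_or_ge v.val ((k + 1) / 2) with hv | hv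
  · exact ⟨(k + 1) / 2, by omega, by omega,
      mem_image.2 ⟨(v.val, (k + 1) / 2), by simp [hmod, hv], by simp⟩⟩
  · have hvk := v.val_lt
    refine ⟨k - (k + 1) / 2, by omega, by omega,
      mem_image.2 ⟨(v.val - (k + 1) / 2, (k + 1) / 2), ?_, ?_⟩⟩
    · simp only [mem_union, mem_product, mem_range, mem_singleton, hmod, one_mul]
      exact Or.inr ⟨by omega, trivial⟩
    · rw [Sym2.eq_swap, Nat.cast_sub hv, Nat.cast_sub (by omega), ZMod.natCast_self,
        ZMod.natCast_zmod_val, sub_add_cancel, zero_sub, ← sub_eq_add_neg]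

theorem card_le_degree_of_forall_adj_add {G : SimpleGraph (ZMod k)} [DecidableRel G.Adj]
    {v : ZMod k} {A : Finset ℕ} (hA : ∀ a ∈ A, a < k ∧ G.Adj v (v + a)) : #A ≤ G.degree v := by
  rw [← G.card_neighborFinset_eq_degree]
  refine card_le_card_of_injOn (fun a => v + a) (fun a ha => by simpa using (hA a ha).2) ?_
  exact fun a ha b hb hab =>
    CharP.natCast_injOn_Iio (ZMod k) k (hA a ha).1 (hA b hb).1 (add_left_cancel hab)

theorem le_degree_hararyGraph [DecidableRel (hararyGraph k d).Adj] (hdk : d < k) (v : ZMod k) :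
    d ≤ (hararyGraph k d).degree v := by
  set A := Icc 1 (d / 2) ∪ Ico (k - d / 2) k with hA
  have hcard : #A = 2 * (d / 2) := by
    rw [card_union_of_disjoint, Nat.card_Icc, Nat.card_Ico]
    · omega
    · refine disjoint_left.2 fun a ha ha' => ?_
      rw [mem_Icc] at ha
      rw [mem_Ico] at ha'
      omega
  have hadj (a) (ha : a ∈ A) : a < k ∧ (hararyGraph k d).Adj v (v + a) := by
    rw [hA, mem_union, mem_Icc, mem_Ico] at ha
    rcases ha with ⟨ha, had⟩ | ⟨ha, hak⟩
    · exact ⟨by omega, hararyGraph_adj_add ha (by omega) (mem_hararyEdges_of_le ha had v)⟩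
    · exact ⟨hak, hararyGraph_adj_add (by omega) hak (mem_hararyEdges_of_ge ha hak v)⟩
  rcases Nat.even_or_odd d with hd | hd
  · have := card_le_degree_of_forall_adj_add hadj
    rwa [hcard, Nat.two_mul_div_two_of_even hd] at this
  · obtain ⟨c, hdc, hck, hc⟩ := exists_chord_mem_hararyEdges hd hdk v
    have hcA : c ∉ A := by
      rw [hA, mem_union, mem_Icc, mem_Ico]
      omega
    have := card_le_degree_of_forall_adj_add (A := insert c A) fun a ha => by
      rcases mem_insert.1 ha with rfl | ha
      · exact ⟨by omega, hararyGraph_adj_add (by omega) (by omega) hc⟩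
      · exact hadj a ha
    rwa [card_insert_of_notMem hcA, hcard, Nat.two_mul_div_two_add_one_of_odd hd] at this

theorem exists_existsLinearSystematicBatchCode_harary (F : Type*) [Field F] {t : ℕ} (htk : t ≤ k) :
    ∃ n, 2 * n ≤ 2 * k + (t - 1) * k + 1 ∧ ExistsLinearSystematicBatchCode F n k 2 t := by
  classical
  have hk := NeZero.pos k
  have hedges : #(hararyGraph k (t - 1)).edgeFinset ≤ #(hararyEdges k (t - 1)) :=
    card_le_card fun e he => by
      have : e ∈ (hararyGraph k (t - 1)).edgeSet := by simpa using he
      rw [hararyGraph, SimpleGraph.edgeSet_fromEdgeSet] at this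
      exact this.1
  have hcount := two_mul_card_hararyEdges_le k (t - 1)
  have hdeg (v : ZMod k) : t ≤ (hararyGraph k (t - 1)).degree v + 1 := by
    have := le_degree_hararyGraph (d := t - 1) (by omega) v
    omega
  refine ⟨k + #(hararyGraph k (t - 1)).edgeFinset, by linarith, ?_⟩
  simpa using existsLinearSystematicBatchCode_graph F hdeg

end HararyGraph

section SimplexCode

variable {R κ : Type*} [Ring R]

/-- The simplex code: the symbols `∑ i ∈ S, x i` for all nonempty sets `S` of positions. -/
def simplexEncoding (R κ : Type*) [Ring R] : (κ → R) →ₗ[R] ({S : Finset κ // S.Nonempty} → R) :=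
  LinearMap.pi fun S => ∑ i ∈ S.1, LinearMap.proj i

theorem simplexEncoding_apply (x : κ → R) (S : {S : Finset κ // S.Nonempty}) :
    simplexEncoding R κ x S = ∑ i ∈ S.1, x i := by
  simp [simplexEncoding]

variable [DecidableEq κ]

/-- The nonempty ones among `S` and `insert a S`. For `a ∉ S` the symbols of the simplex code at
these two sets differ by `x a`. -/
def simplexPair (a : κ) (S : Finset κ) : Finset {S : Finset κ // S.Nonempty} :=
  Finset.subtype _ {S, insert a S}

theorem card_simplexPair_le (a : κ) (S : Finset κ) : #(simplexPair a S) ≤ 2 := by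
  rw [simplexPair, card_subtype]
  exact (card_filter_le _ _).trans card_le_two

theorem isRecoverySet_simplexPair {a : κ} {S : Finset κ} (ha : a ∉ S) :
    IsRecoverySet (simplexEncoding R κ) a (simplexPair a S) := by
  intro x hx
  have hsum (T : Finset κ) (hT : T ∈ ({S, insert a S} : Finset (Finset κ))) :
      ∑ i ∈ T, x i = 0 := by
    rcases T.eq_empty_or_nonempty with rfl | hne
    · simp
    · simpa only [simplexEncoding_apply] using hx ⟨T, hne⟩ (mem_subtype.2 hT)
  have hinsert := hsum (insert a S) (by simp)
  rwa [sum_insert ha, hsum S (by simp), add_zero] at hinsert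

theorem exists_disjoint_simplexPair : ∀ a b c d : Fin 3,
    ∃ S, b ∉ S ∧ Disjoint (simplexPair b S) (simplexPair a ∅) ∧
    ∃ T, c ∉ T ∧ Disjoint (simplexPair c T) (simplexPair a ∅) ∧
      Disjoint (simplexPair c T) (simplexPair b S) ∧
    ∃ U, d ∉ U ∧ Disjoint (simplexPair d U) (simplexPair a ∅) ∧
      Disjoint (simplexPair d U) (simplexPair b S) ∧
      Disjoint (simplexPair d U) (simplexPair c T) := by
  -- The nesting lets the evaluation discard a partial choice at its first conflict.
  decide +kernel

theorem exists_pairwise_disjoint_simplexPair (i : Fin 4 → Fin 3) :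
    ∃ S : Fin 4 → Finset (Fin 3), (∀ l, i l ∉ S l) ∧
      Pairwise (Disjoint on fun l => simplexPair (i l) (S l)) := by
  obtain ⟨S, hS, hSa, T, hT, hTa, hTS, U, hU, hUa, hUS, hUT⟩ :=
    exists_disjoint_simplexPair (i 0) (i 1) (i 2) (i 3)
  refine ⟨![∅, S, T, U], by simp [Fin.forall_fin_succ, hS, hT, hU],
    (pairwise_disjoint_on _).2 fun l m hlm => disjoint_comm.1 ?_⟩
  revert l m
  simp [Fin.forall_fin_succ, hSa, hTa, hTS, hUa, hUS, hUT]

theorem hasRecoverySets_simplexEncoding : HasRecoverySets 2 4 (simplexEncoding R (Fin 3)) := by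
  intro i
  obtain ⟨S, hS, hdisj⟩ := exists_pairwise_disjoint_simplexPair i
  exact ⟨_, hdisj, fun l => ⟨card_simplexPair_le _ _, isRecoverySet_simplexPair (hS l)⟩⟩

theorem existsLinearSystematicBatchCode_simplex (F : Type*) [Field F] :
    ExistsLinearSystematicBatchCode F 7 3 2 4 :=
  (hasRecoverySets_simplexEncoding (R := F)).existsLinearSystematicBatchCode
    ⟨fun a => ⟨{a}, singleton_nonempty a⟩,
      fun _ _ h => singleton_injective (congrArg Subtype.val h)⟩
    fun x a => (simplexEncoding_apply x _).trans (sum_singleton x a)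

end SimplexCode

section Availability

variable {F W ι : Type*} [DivisionRing F] [AddCommGroup W] [Module F W]

theorem mem_sup_span_singleton_exchange {V : Submodule F W} {u w : W} (hu : u ∈ V ⊔ F ∙ w)
    (huV : u ∉ V) : w ∈ V ⊔ F ∙ u := by
  rw [← span_eq V, sup_comm, ← span_union, Set.singleton_union] at hu ⊢
  exact mem_span_insert_exchange hu (by rwa [span_eq])

theorem finrank_sup_span_image_le [FiniteDimensional F W] (e : ι → W) (V : Submodule F W)
    (A : Finset ι) : finrank F ↥(V ⊔ span F (e '' A)) ≤ finrank F V + #A := by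
  classical
  refine (finrank_add_le_finrank_add_finrank V _).trans (Nat.add_le_add_left ?_ _)
  rw [← coe_image]
  exact (finrank_span_finset_le_card _).trans card_image_le

/-- The coordinate `s` of the linear code with coordinate functionals `e`, taken as vectors of an
arbitrary space, has `(r, d)`-availability: it has `d` pairwise disjoint recovery sets of at most
`r` coordinates other than `s`. -/
def HasAvailability (F : Type*) [DivisionRing F] [Module F W] (e : ι → W) (r d : ℕ) (s : ι) :
    Prop :=
  ∃ P : Fin d → Finset ι, Pairwise (Disjoint on P) ∧
    ∀ l, s ∉ P l ∧ #(P l) ≤ r ∧ e s ∈ span F (e '' P l)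

variable [Fintype ι]

open Classical in
/-- The coordinates of the linear code with coordinate functionals `e` whose functional lies in
`V`. The lower bound seeks a proper subspace `V` with many of them. -/
noncomputable def coordinatesIn (e : ι → W) (V : Submodule F W) : Finset ι := {j | e j ∈ V}

variable {e : ι → W} {V V' : Submodule F W}

@[simp]
theorem mem_coordinatesIn {j : ι} : j ∈ coordinatesIn e V ↔ e j ∈ V := by
  simp [coordinatesIn]

theorem coordinatesIn_mono (h : V ≤ V') : coordinatesIn e V ⊆ coordinatesIn e V' :=
  fun _ hj => mem_coordinatesIn.2 (h (mem_coordinatesIn.1 hj))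

theorem one_le_card_new_or_two_le_card_new [DecidableEq ι] {P : Finset ι} {u : W} (hP : #P ≤ 2)
    (hu : u ∈ span F (e '' P)) (huV : u ∉ V) :
    1 ≤ #(P ∩ (coordinatesIn e (V ⊔ F ∙ u) \ coordinatesIn e V)) ∨
      ∃ b ∈ P, 2 ≤ #(P ∩ (coordinatesIn e (V ⊔ F ∙ u ⊔ F ∙ e b) \ coordinatesIn e V)) := by
  simp only [or_iff_not_imp_left, one_le_card, Finset.Nonempty, mem_inter, mem_sdiff,
    mem_coordinatesIn, not_exists, not_and, not_not]
  intro huntouched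
  have hspan {U : Submodule F W} (hU : ∀ j ∈ P, e j ∈ U) : u ∈ U :=
    span_le.2 (Set.image_subset_iff.2 hU) hu
  obtain ⟨b, hbP, hbV⟩ : ∃ b ∈ P, e b ∉ V := by
    by_contra! h
    exact huV (hspan h)
  have hub : u ∉ V ⊔ F ∙ e b := fun h =>
    hbV (huntouched b hbP (mem_sup_span_singleton_exchange h huV))
  obtain ⟨c, hcP, hcb⟩ : ∃ c ∈ P, e c ∉ V ⊔ F ∙ e b := by
    by_contra! h
    exact hub (hspan h)
  have hcV : e c ∉ V := fun h => hcb (le_sup_left (a := V) h)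
  have hbc : b ≠ c := by
    rintro rfl
    exact hcb (le_sup_right (a := V) (mem_span_singleton_self _))
  have hPbc : {b, c} = P :=
    eq_of_subset_of_card_le (by simp [insert_subset_iff, hbP, hcP]) (by rwa [card_pair hbc])
  have hc : e c ∈ V ⊔ F ∙ u ⊔ F ∙ e b := by
    rw [sup_right_comm]
    refine mem_sup_span_singleton_exchange (hspan fun j hj => ?_) hub
    rw [← hPbc, mem_insert, mem_singleton] at hj
    rcases hj with rfl | rfl
    · exact le_sup_left (a := V ⊔ _) (le_sup_right (a := V) (mem_span_singleton_self _))
    · exact le_sup_right (a := V ⊔ _) (mem_span_singleton_self _)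
  have hb : e b ∈ V ⊔ F ∙ u ⊔ F ∙ e b :=
    le_sup_right (a := V ⊔ _) (mem_span_singleton_self _)
  refine ⟨b, hbP, (card_pair hbc).symm.trans_le (card_le_card ?_)⟩
  simp [insert_subset_iff, hbP, hcP, hb, hbV, hc, hcV]

theorem card_coordinatesIn_add_sum_card_new_le [DecidableEq ι] (hV : V ≤ V') {s : ι}
    (hs : e s ∈ V') (hsV : e s ∉ V) {d : ℕ} {P : Fin d → Finset ι} (hP : Pairwise (Disjoint on P))
    (hsP : ∀ l, s ∉ P l) :
    #(coordinatesIn e V) + 1 + ∑ l, #(P l ∩ (coordinatesIn e V' \ coordinatesIn e V)) ≤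
      #(coordinatesIn e V') := by
  set N := coordinatesIn e V' \ coordinatesIn e V with hN
  have hunion : ∑ l, #(P l ∩ N) = #(univ.biUnion fun l => P l ∩ N) :=
    (card_biUnion fun l _ m _ hlm => (hP hlm).mono inter_subset_left inter_subset_left).symm
  have hlt : (univ.biUnion fun l => P l ∩ N) ⊂ N := by
    refine ssubset_iff_of_subset ?_ |>.2 ⟨s, by simp [hN, hs, hsV], by simp [hsP]⟩
    exact biUnion_subset.2 fun l _ => inter_subset_right
  have hcard := card_lt_card hlt
  rw [hN, card_sdiff_of_subset (coordinatesIn_mono hV), ← hunion] at hcard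
  omega

theorem card_add_two_mul_card_le_sum_add_card {α : Type*} [Fintype α] {f : α → ℕ}
    {J T : Finset α} (hJT : J ⊆ T) (hT : ∀ l ∉ T, 1 ≤ f l) (hJ : ∀ l ∈ J, 2 ≤ f l) :
    Fintype.card α + 2 * #J ≤ ∑ l, f l + #T := by
  classical
  have hcompl : #Tᶜ ≤ ∑ l ∈ Tᶜ, f l := by
    simpa using card_nsmul_le_sum Tᶜ f 1 fun l hl => hT l (mem_compl.1 hl)
  have hsub : #J * 2 ≤ ∑ l ∈ T, f l :=
    (card_nsmul_le_sum J f 2 hJ).trans (sum_le_sum_of_subset hJT)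
  have hsum := sum_add_sum_compl T f
  have hcard := card_add_card_compl T
  omega

theorem HasAvailability.exists_card_coordinatesIn_le [FiniteDimensional F W] {d : ℕ} {s : ι}
    (h : HasAvailability F e 2 d s) (hsV : e s ∉ V) :
    ∃ m ≤ d, ∀ b ≤ m, ∃ V' : Submodule F W, finrank F V' ≤ finrank F V + (b + 1) ∧
      #(coordinatesIn e V) + 1 + d + 2 * b ≤ #(coordinatesIn e V') + m := by
  classical
  obtain ⟨P, hP, hPs⟩ := h
  have : Nonempty ι := ⟨s⟩
  set U := V ⊔ F ∙ e s
  let gain (V' : Submodule F W) (l : Fin d) := #(P l ∩ (coordinatesIn e V' \ coordinatesIn e V))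
  have hmono {V₁ V₂ : Submodule F W} (h : V₁ ≤ V₂) (l) : gain V₁ l ≤ gain V₂ l :=
    card_le_card (inter_subset_inter_left (sdiff_subset_sdiff (coordinatesIn_mono h) subset_rfl))
  have hgain (l) : 1 ≤ gain U l ∨ ∃ b ∈ P l, 2 ≤ gain (U ⊔ F ∙ e b) l :=
    one_le_card_new_or_two_le_card_new (hPs l).2.1 (hPs l).2.2 hsV
  let T : Finset (Fin d) := {l | ¬ 1 ≤ gain U l}
  have hT (l) : l ∈ T ↔ ¬ 1 ≤ gain U l := mem_filter_univ l
  choose! b _ hb using fun l hl => (hgain l).resolve_left ((hT l).1 hl)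
  refine ⟨#T, (card_le_univ T).trans_eq (Fintype.card_fin d), fun B hB => ?_⟩
  obtain ⟨J, hJT, rfl⟩ := exists_subset_card_eq hB
  set A := insert s (J.image b)
  set V' := V ⊔ span F (e '' A)
  have hAV' {j} (hj : j ∈ A) : F ∙ e j ≤ V' :=
    (span_singleton_le_iff_mem _ _).2 (mem_sup_right (subset_span (Set.mem_image_of_mem e hj)))
  have hUV' : U ≤ V' := sup_le le_sup_left (hAV' (mem_insert_self _ _))
  have hbV' (l) (hl : l ∈ J) : U ⊔ F ∙ e (b l) ≤ V' :=
    sup_le hUV' (hAV' (mem_insert_of_mem (mem_image_of_mem b hl)))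
  have hAcard : #A ≤ #J + 1 := (card_insert_le _ _).trans (Nat.succ_le_succ card_image_le)
  have hcount := card_coordinatesIn_add_sum_card_new_le le_sup_left
    (hUV' (le_sup_right (a := V) (mem_span_singleton_self _))) hsV hP fun l => (hPs l).1
  have hsum : d + 2 * #J ≤ ∑ l, gain V' l + #T := by
    simpa using card_add_two_mul_card_le_sum_add_card hJT
      (fun l hl => (not_not.1 (mt (hT l).2 hl)).trans (hmono hUV' l))
      fun l hl => (hb l (hJT hl)).trans (hmono (hbV' l hl) l)
  refine ⟨V', (finrank_sup_span_image_le e V A).trans (Nat.add_le_add_left hAcard _), ?_⟩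
  simp only [gain] at hsum
  omega

theorem exists_finrank_le_two_mul_le_card_coordinatesIn [FiniteDimensional F W] {d D : ℕ}
    (hspan : span F (e '' {s | HasAvailability F e 2 d s}) = ⊤) (hD : D < finrank F W) :
    ∃ V : Submodule F W, finrank F V ≤ D ∧
      2 * D ≤ #(coordinatesIn e V) + (D + d) / (d + 1) := by
  classical
  let IsRich (c : ℕ) : Prop := ∃ V : Submodule F W, finrank F V ≤ c ∧
    2 * c ≤ #(coordinatesIn e V) + c / (d + 1)
  have hrich : IsRich (Nat.findGreatest IsRich D) :=
    Nat.findGreatest_spec (Nat.zero_le D) ⟨⊥, by simp, by simp⟩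
  have hmax {c : ℕ} (hcD : c ≤ D) (hc : IsRich c) := Nat.le_findGreatest hcD hc
  have hcD := Nat.findGreatest_le (P := IsRich) D
  generalize Nat.findGreatest IsRich D = c at hrich hmax hcD
  obtain ⟨V, hVc, hV⟩ := hrich
  rcases hcD.eq_or_lt with rfl | hcD
  · exact ⟨V, hVc, hV.trans (Nat.add_le_add_left (Nat.div_le_div_right (by omega)) _)⟩
  obtain ⟨s, hs, hsV⟩ : ∃ s, HasAvailability F e 2 d s ∧ e s ∉ V := by
    by_contra! h
    have : V = ⊤ := top_le_iff.1 <| hspan.symm.le.trans <| span_le.2 <| Set.image_subset_iff.2 h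
    rw [this, finrank_top] at hVc
    omega
  obtain ⟨m, hmd, hm⟩ := hs.exists_card_coordinatesIn_le hsV
  have hdiv : (c + (d + 1)) / (d + 1) = c / (d + 1) + 1 := Nat.add_div_right c d.succ_pos
  rcases le_or_gt (c + 1 + m) D with hle | hgt
  · obtain ⟨V', hfin, hcard⟩ := hm m le_rfl
    have hdivm : (c + (m + 1)) / (d + 1) + d ≥ c / (d + 1) + 1 + m := by
      rcases hmd.eq_or_lt with rfl | hmd
      · omega
      · have := Nat.div_le_div_right (c := d + 1) (show c ≤ c + (m + 1) by omega)
        omega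
    have := hmax hle ⟨V', by omega, by rw [add_assoc c 1 m, add_comm 1 m]; omega⟩
    omega
  · obtain ⟨V', hfin, hcard⟩ := hm (D - 1 - c) (by omega)
    have := Nat.div_le_div_right (c := d + 1) (show c + (d + 1) ≤ D + d by omega)
    exact ⟨V', by omega, by omega⟩

end Availability

section LowerBound

variable {F ι κ : Type*} [Field F] {r t d : ℕ} {g : (κ → F) →ₗ[F] (ι → F)}

/-- The `j`-th coordinate of the codeword, as a linear functional of the information vector; on
these vectors of the dual space the recovery sets become spanning conditions. -/
def coordinateFunctional (g : (κ → F) →ₗ[F] (ι → F)) (j : ι) : Dual F (κ → F) :=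
  LinearMap.proj j ∘ₗ g

theorem IsRecoverySet.proj_mem_span {a : κ} {P : Finset ι} (h : IsRecoverySet g a P) :
    (LinearMap.proj a : Dual F (κ → F)) ∈ span F (coordinateFunctional g '' P) := by
  rw [Set.image_eq_range]
  refine mem_span_of_iInf_ker_le_ker fun x hx => h x fun j hj => ?_
  exact (mem_iInf _).1 hx ⟨j, hj⟩

theorem HasRecoverySets.hasAvailability (h : HasRecoverySets r (d + 1) g) {a : κ} {s : ι}
    (hs : ∀ x, g x s = x a) : HasAvailability F (coordinateFunctional g) r d s := by
  obtain ⟨P, hdisj, hP⟩ := h fun _ => a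
  obtain ⟨l₀, hl₀⟩ : ∃ l₀, ∀ l ≠ l₀, s ∉ P l := by
    by_cases hsP : ∃ l₀, s ∈ P l₀
    · exact hsP.imp fun l₀ hl₀ l hl hsl => disjoint_left.1 (hdisj hl) hsl hl₀
    · exact ⟨0, fun l _ => not_exists.1 hsP l⟩
  have hes : coordinateFunctional g s = LinearMap.proj a := LinearMap.ext hs
  exact ⟨P ∘ l₀.succAbove, fun l m hlm => hdisj (Fin.succAbove_right_injective.ne hlm),
    fun l => ⟨hl₀ _ (Fin.succAbove_ne l₀ l), (hP _).1, hes ▸ (hP _).2.proj_mem_span⟩⟩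

variable [Fintype ι]

theorem HasRecoverySets.le_hammingNorm [DecidableEq F] (h : HasRecoverySets r t g)
    {x : κ → F} (hx : x ≠ 0) : t ≤ hammingNorm (g x) := by
  obtain ⟨a, ha⟩ := Function.ne_iff.1 hx
  obtain ⟨P, hdisj, hP⟩ := h fun _ => a
  have hne (l) : ∃ j ∈ P l, g x j ≠ 0 := by
    by_contra! hzero
    exact ha ((hP l).2 x hzero)
  choose j hjP hj using hne
  have hinj : Function.Injective j := fun l m hlm =>
    hdisj.eq (not_disjoint_iff.2 ⟨j l, hjP l, hlm ▸ hjP m⟩)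
  rw [hammingNorm, ← Fintype.card_fin t, ← card_univ]
  exact card_le_card_of_injOn j (fun l _ => by simpa using hj l) hinj.injOn

theorem HasRecoverySets.add_card_coordinatesIn_le [Finite κ] (h : HasRecoverySets r t g)
    {V : Submodule F (Dual F (κ → F))} (hV : V ≠ ⊤) :
    t + #(coordinatesIn (coordinateFunctional g) V) ≤ Fintype.card ι := by
  classical
  have hcoann : V.dualCoannihilator ≠ ⊥ := fun hbot => hV <| by
    rw [← Subspace.dualCoannihilator_dualAnnihilator_eq (W := V), hbot, dualAnnihilator_bot]
  obtain ⟨x, hxV, hx⟩ := exists_mem_ne_zero_of_ne_bot hcoann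
  have hzero : coordinatesIn (coordinateFunctional g) V ⊆ ({j | g x j ≠ 0} : Finset ι)ᶜ :=
    fun j hj => by
      simpa [coordinateFunctional] using (mem_dualCoannihilator x).1 hxV _ (mem_coordinatesIn.1 hj)
  have hcompl := card_add_card_compl ({j | g x j ≠ 0} : Finset ι)
  have hdist := h.le_hammingNorm hx
  rw [hammingNorm] at hdist
  have := card_le_card hzero
  omega

theorem HasRecoverySets.add_two_mul_le_card [Fintype κ] (h : HasRecoverySets 2 (d + 1) g)
    {s : κ → ι} (hs : ∀ x a, g x (s a) = x a) {D : ℕ} (hD : D < Fintype.card κ) :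
    d + 1 + 2 * D ≤ Fintype.card ι + (D + d) / (d + 1) := by
  have hspan : span F (coordinateFunctional g ''
      {j | HasAvailability F (coordinateFunctional g) 2 d j}) = ⊤ := by
    classical
    rw [eq_top_iff, ← (Pi.basisFun F κ).dualBasis.span_eq]
    refine span_mono <| Set.range_subset_iff.2 fun a =>
      ⟨s a, h.hasAvailability fun x => hs x a, ?_⟩
    ext x
    simp [coordinateFunctional, hs, Pi.single_apply]
  have hfinrank : finrank F (Dual F (κ → F)) = Fintype.card κ := by
    rw [Subspace.dual_finrank_eq, finrank_fintype_fun_eq_card]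
  obtain ⟨V, hV, hcard⟩ :=
    exists_finrank_le_two_mul_le_card_coordinatesIn hspan (hD.trans_eq hfinrank.symm)
  have hVtop : V ≠ ⊤ := by
    rintro rfl
    rw [finrank_top] at hV
    omega
  have := h.add_card_coordinatesIn_le hVtop
  omega

end LowerBound

section OptimalLength

variable {F : Type*} [Field F] {k t n : ℕ}

theorem ExistsLinearSystematicBatchCode.add_ceil_le (h : ExistsLinearSystematicBatchCode F n k 2 t)
    (hk : 1 ≤ k) (ht : 0 < t) :
    (k : ℤ) + (t : ℤ) - 2 + ⌈(((t : ℚ) - 1) * ((k : ℚ) - 1) + 1) / (t : ℚ)⌉ ≤ n := by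
  obtain ⟨D, rfl⟩ := Nat.exists_eq_add_of_le' hk
  obtain ⟨d, rfl⟩ := Nat.exists_eq_add_of_le' ht
  obtain ⟨g, ⟨s, hs⟩, hg⟩ := h
  have hbound : d + 1 + 2 * D ≤ n + (D + d) / (d + 1) := by
    simpa using hg.hasRecoverySets.add_two_mul_le_card hs (D := D) (by simp)
  have hmul : (d + 1) * (d + 1 + 2 * D) ≤ (d + 1) * n + (D + d) :=
    (Nat.mul_le_mul_left _ hbound).trans <| by
      rw [mul_add]
      exact Nat.add_le_add_left (Nat.mul_div_le _ _) _
  have hceil : ⌈((((d + 1 : ℕ) : ℚ) - 1) * (((D + 1 : ℕ) : ℚ) - 1) + 1) / ((d + 1 : ℕ) : ℚ)⌉ ≤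
      (n : ℤ) - D - d := by
    rw [Int.ceil_le, div_le_iff₀ (by positivity)]
    have : (d + 1 : ℚ) * (d + 1 + 2 * D) ≤ (d + 1) * n + (D + d) := by exact_mod_cast hmul
    push_cast
    linarith
  push_cast at hceil ⊢
  linarith

theorem exists_existsLinearSystematicBatchCode_le_add_ceil (F : Type*) [Field F] (hk : 1 ≤ k)
    (ht : 0 < t) (htk : t ≤ k ∨ k = 3 ∧ t = 4) :
    ∃ n : ℕ, (n : ℤ) ≤ (k : ℤ) + ⌈((t : ℚ) - 1) * ((k : ℚ) / 2)⌉ ∧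
      ExistsLinearSystematicBatchCode F n k 2 t := by
  obtain ⟨n, hn, hcode⟩ :
      ∃ n, 2 * n ≤ 2 * k + (t - 1) * k + 1 ∧ ExistsLinearSystematicBatchCode F n k 2 t := by
    rcases htk with htk | ⟨rfl, rfl⟩
    · have : NeZero k := ⟨by omega⟩
      exact exists_existsLinearSystematicBatchCode_harary F htk
    · exact ⟨7, by norm_num, existsLinearSystematicBatchCode_simplex F⟩
  refine ⟨n, ?_, hcode⟩
  obtain ⟨d, rfl⟩ := Nat.exists_eq_add_of_le' ht
  have hceil := Int.le_ceil ((((d + 1 : ℕ) : ℚ) - 1) * ((k : ℚ) / 2))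
  generalize ⌈(((d + 1 : ℕ) : ℚ) - 1) * ((k : ℚ) / 2)⌉ = c at hceil ⊢
  have hdk : ((d * k : ℕ) : ℤ) ≤ 2 * c := by
    have : ((d * k : ℕ) : ℚ) ≤ 2 * c := by
      push_cast at hceil ⊢
      linarith
    exact_mod_cast this
  rw [Nat.add_sub_cancel] at hn
  omega

end OptimalLength

theorem mainTheorem4_general (F : Type*) [Field F] (k t : ℕ) (hk : 1 ≤ k) (ht : 0 < t) :
    ExistsLinearSystematicBatchCode F (optimalBatchLength F k 2 t) k 2 t ∧
    (k : ℤ) + (t : ℤ) - 2 + ⌈(((t : ℚ) - 1) * ((k : ℚ) - 1) + 1) / (t : ℚ)⌉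
      ≤ (optimalBatchLength F k 2 t : ℤ) ∧
    (t ≤ k ∨ k = 3 ∧ t = 4 →
      (optimalBatchLength F k 2 t : ℤ) ≤ (k : ℤ) + ⌈((t : ℚ) - 1) * ((k : ℚ) / 2)⌉) := by
  have hattained : ExistsLinearSystematicBatchCode F (optimalBatchLength F k 2 t) k 2 t :=
    Nat.sInf_mem (s := {n | ExistsLinearSystematicBatchCode F n k 2 t})
      ⟨k * t, existsLinearSystematicBatchCode_repetition F k one_le_two ht⟩
  refine ⟨hattained, hattained.add_ceil_le hk ht, fun htk => ?_⟩
  obtain ⟨n, hn, hcode⟩ := exists_existsLinearSystematicBatchCode_le_add_ceil F hk ht htk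
  have : optimalBatchLength F k 2 t ≤ n := Nat.sInf_le hcode
  omega

theorem mainTheorem4 (F : Type*) [Field F] [Finite F] (k t : ℕ) (hk : 1 ≤ k)
    (ht : t = 3 ∨ t = 4) :
    ExistsLinearSystematicBatchCode F (optimalBatchLength F k 2 t) k 2 t ∧
    (k : ℤ) + (t : ℤ) - 2 + ⌈(((t : ℚ) - 1) * ((k : ℚ) - 1) + 1) / (t : ℚ)⌉
      ≤ (optimalBatchLength F k 2 t : ℤ) ∧
    (3 ≤ k →
      (optimalBatchLength F k 2 t : ℤ) ≤ (k : ℤ) + ⌈((t : ℚ) - 1) * ((k : ℚ) / 2)⌉) := by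
  obtain ⟨hattained, hlower, hupper⟩ := mainTheorem4_general F k t hk (by omega)
  exact ⟨hattained, hlower, fun hk3 => hupper (by omega)⟩
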